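/- Let $d\ge 2$ be an integer and let $L$ be a complex $d\times d$ matrix with $\|L\|_2=1$, where $\|X\|_p=\big(\operatorname{Tr}[(XX^\dagger)^{p/2}]\big)^{1/p}$ is the Schatten $p$-norm. Let $\mathcal L(\rho)=L\rho L^\dagger-\frac12\{L^\dagger L,\rho\}$ be the Lindbladian on the $d$-dimensional system $1$ with Lindblad operator $L$, and let $e^{\mathcal L t}(\rho)=\sum_{k\ge0}\frac{t^k}{k!}\mathcal L^k(\rho)$. Let $|\Gamma\rangle=\sum_{i=1}^d|i\rangle|i\rangle$, let $|\psi_L\rangle=(L\otimes I)|\Gamma\rangle$ and $\psi_L=|\psi_L\rangle\langle\psi_L|$ be the program state, on two further $d$-dimensional systems $2,3$. Put $$M=\tfrac1{\sqrt d}\,\big(I_1\otimes|\Gamma\rangle\langle\Gamma|_{23}\big)\big(\mathrm{SWAP}_{12}\otimes I_3\big),\qquad \mathcal M(\omega)=M\omega M^\dagger-\tfrac12\{M^\dagger M,\omega\},$$ where $\mathrm{SWAP}=\sum_{i,j}|i\rangle\langle j|\otimes|j\rangle\langle i|$, and let one step of wave matrix Lindbladization for time $\Delta$ be the map $$\widetilde{e^{\mathcal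 L\Delta}}(\rho)=\operatorname{Tr}_{23}\big[e^{\mathcal M\Delta}(\rho\otimes\psi_L)\big].$$ Let $t\ge0$, let $n\in\mathbb N$ satisfy $n>2dt$, and let $\Delta=t/n$. Then $$\frac12\Big\|e^{\mathcal Lt}-\big(\widetilde{e^{\mathcal L\Delta}}\big)^n\Big\|_\diamond\le\frac{3t^2d^2}{n},$$ where $\|\mathcal N-\mathcal N'\|_\diamond=\sup_{\rho}\|(\mathcal I_R\otimes\mathcal N)(\rho)-(\mathcal I_R\otimes\mathcal N')(\rho)\|_1$, the supremum being over all finite-dimensional reference systems $R$ and all density operators $\rho$ on the tensor product of $R$ with the system. -/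

import Mathlib

open Matrix Kronecker

open scoped MatrixOrder ComplexOrder ENNReal Nat

noncomputable section

namespace WML

/-- The Schatten `p`-norm `(Tr[(X X†)^(p/2)])^(1/p)`; the power of the positive semidefinite matrix
`X X†` is the one of the continuous functional calculus, so that the trace is a nonnegative real. -/
def schattenNorm {n : Type*} [Fintype n] [DecidableEq n] (p : ℝ) (X : Matrix n n ℂ) : ℝ :=
  ((CFC.rpow (X * Xᴴ) (p / 2)).trace.re) ^ (1 / p)

/-- Density operators: positive semidefinite matrices of unit trace. -/
def IsDensity {n : Type*} [Fintype n] (ρ : Matrix n n ℂ) : Prop :=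
  ρ.PosSemidef ∧ ρ.trace = 1

/-- `id_R ⊗ N` on operators on `R ⊗ S`: the map `N` is applied to every `S`-block
`(⟨i| ⊗ I) X (|j⟩ ⊗ I)`. -/
def idTensor {n : Type*} (r : Type*) (N : Module.End ℂ (Matrix n n ℂ)) :
    Module.End ℂ (Matrix (r × n) (r × n) ℂ) where
  toFun X := Matrix.of fun p q => N (Matrix.of fun a b => X (p.1, a) (q.1, b)) p.2 q.2
  map_add' X Y := by
    ext p q
    simp only [Matrix.of_apply, Matrix.add_apply]
    rw [← Matrix.add_apply, ← map_add]
    rfl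
  map_smul' c X := by
    ext p q
    simp only [Matrix.of_apply, Matrix.smul_apply, RingHom.id_apply]
    rw [← Matrix.smul_apply, ← map_smul]
    rfl

/-- The normalized diamond distance `½‖N - M‖_⋄`, half of the supremum over all finite-dimensional
reference systems `R` and all states `ρ` of `R ⊗ S` of `‖(id_R ⊗ N)(ρ) - (id_R ⊗ M)(ρ)‖₁`.
The supremum is taken in `[0, ∞]`. -/
def diamondDist {n : Type*} [Fintype n] [DecidableEq n] (N M : Module.End ℂ (Matrix n n ℂ)) :
    ℝ≥0∞ :=
  (1 / 2) * ⨆ (r : ℕ) (ρ : Matrix (Fin r × n) (Fin r × n) ℂ) (_ : IsDensity ρ),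
    ENNReal.ofReal (schattenNorm 1 (idTensor (Fin r) N ρ - idTensor (Fin r) M ρ))

/-- The Lindbladian `ρ ↦ L ρ L† - ½ {L†L, ρ}` with the single Lindblad operator `L`. -/
def lindbladian {n : Type*} [Fintype n] (L : Matrix n n ℂ) : Module.End ℂ (Matrix n n ℂ) where
  toFun ρ := L * ρ * Lᴴ - (1 / 2 : ℂ) • (Lᴴ * L * ρ + ρ * (Lᴴ * L))
  map_add' ρ σ := by
    simp only [Matrix.mul_add, Matrix.add_mul, smul_add]
    abel
  map_smul' c ρ := by
    simp only [Matrix.mul_smul, Matrix.smul_mul, RingHom.id_apply, smul_sub, smul_add,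
      smul_comm c (1 / 2 : ℂ)]

/-- The exponential series of a linear map on a finite-dimensional space converges pointwise. -/
theorem summable_exp_apply {V : Type*} [NormedAddCommGroup V] [NormedSpace ℂ V]
    [FiniteDimensional ℂ V] (A : Module.End ℂ V) (t : ℝ) (X : V) :
    Summable fun k : ℕ => ((t : ℂ) ^ k / (k ! : ℂ)) • (A ^ k) X := by
  let B : V →L[ℂ] V := LinearMap.toContinuousLinearMap A
  have hB : ∀ k : ℕ, ‖(A ^ k) X‖ ≤ ‖B‖ ^ k * ‖X‖ := by
    intro k
    induction k with
    | zero => simp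
    | succ k ih =>
      rw [pow_succ', pow_succ', mul_assoc]
      exact (B.le_opNorm ((A ^ k) X)).trans (mul_le_mul_of_nonneg_left ih (norm_nonneg B))
  have := FiniteDimensional.complete ℂ V
  refine Summable.of_norm_bounded
    (g := fun k : ℕ => ((|t| * ‖B‖) ^ k / (k ! : ℝ)) * ‖X‖)
    ((Real.summable_pow_div_factorial _).mul_right _) fun k => ?_
  have h : ‖((t : ℂ) ^ k / (k ! : ℂ))‖ = |t| ^ k / (k ! : ℝ) := by
    simp
  rw [norm_smul, h, mul_pow, mul_div_right_comm, mul_assoc]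
  exact mul_le_mul_of_nonneg_left (hB k) (by positivity)

/-- The exponential series of a linear map on matrices converges pointwise. -/
theorem summable_semigroup {n : Type*} [Fintype n] (A : Module.End ℂ (Matrix n n ℂ)) (t : ℝ)
    (X : Matrix n n ℂ) : Summable fun k : ℕ => ((t : ℂ) ^ k / (k ! : ℂ)) • (A ^ k) X :=
  @summable_exp_apply (Matrix n n ℂ) Matrix.normedAddCommGroup Matrix.normedSpace _ A t X

/-- The map `e^{At}`, with `e^{At}(X) = ∑ₖ (tᵏ / k!) Aᵏ(X)`. -/
def semigroup {n : Type*} [Fintype n] (A : Module.End ℂ (Matrix n n ℂ)) (t : ℝ) :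
    Module.End ℂ (Matrix n n ℂ) where
  toFun X := ∑' k : ℕ, ((t : ℂ) ^ k / (k ! : ℂ)) • (A ^ k) X
  map_add' X Y := by
    simp only [map_add, smul_add]
    exact (summable_semigroup A t X).tsum_add (summable_semigroup A t Y)
  map_smul' c X := by
    simp only [map_smul, RingHom.id_apply, smul_comm _ c]
    exact (summable_semigroup A t X).tsum_const_smul c

/-- The unnormalized maximally entangled vector `|Γ⟩ = ∑ᵢ |i⟩|i⟩`. -/
def gammaVec (d : ℕ) : Fin d × Fin d → ℂ := fun p => if p.1 = p.2 then 1 else 0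

/-- The program state `ψ_L = |ψ_L⟩⟨ψ_L|` with `|ψ_L⟩ = (L ⊗ I)|Γ⟩`. -/
def programState {d : ℕ} (L : Matrix (Fin d) (Fin d) ℂ) :
    Matrix (Fin d × Fin d) (Fin d × Fin d) ℂ :=
  vecMulVec ((L ⊗ₖ (1 : Matrix (Fin d) (Fin d) ℂ)) *ᵥ gammaVec d)
    (star ((L ⊗ₖ (1 : Matrix (Fin d) (Fin d) ℂ)) *ᵥ gammaVec d))

/-- The swap operator `∑ᵢⱼ |i⟩⟨j| ⊗ |j⟩⟨i|`. -/
def swapOp (d : ℕ) : Matrix (Fin d × Fin d) (Fin d × Fin d) ℂ :=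
  ∑ i, ∑ j, Matrix.single i j (1 : ℂ) ⊗ₖ Matrix.single j i (1 : ℂ)

/-- The fixed operator `M = d^{-1/2} (I₁ ⊗ |Γ⟩⟨Γ|₂₃) (SWAP₁₂ ⊗ I₃)` on the systems `1, 2, 3`,
indexed as `1 × (2 × 3)`. -/
def wmlOp (d : ℕ) : Matrix (Fin d × (Fin d × Fin d)) (Fin d × (Fin d × Fin d)) ℂ :=
  ((1 / Real.sqrt d : ℝ) : ℂ) •
    (((1 : Matrix (Fin d) (Fin d) ℂ) ⊗ₖ vecMulVec (gammaVec d) (star (gammaVec d))) *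
      Matrix.reindex (Equiv.prodAssoc _ _ _) (Equiv.prodAssoc _ _ _)
        (swapOp d ⊗ₖ (1 : Matrix (Fin d) (Fin d) ℂ)))

/-- The partial trace over the second tensor factor. -/
def partialTrace {n m : Type*} [Fintype m] (X : Matrix (n × m) (n × m) ℂ) : Matrix n n ℂ :=
  Matrix.of fun i j => ∑ k, X (i, k) (j, k)

/-- One step of wave matrix Lindbladization for the time `Δ`:
`ρ ↦ Tr₂₃[e^{𝓜 Δ}(ρ ⊗ ψ_L)]`, where `𝓜` is the Lindbladian of `wmlOp d`. -/
def wmlStep {d : ℕ} (L : Matrix (Fin d) (Fin d) ℂ) (Δ : ℝ) :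
    Module.End ℂ (Matrix (Fin d) (Fin d) ℂ) where
  toFun ρ := partialTrace (semigroup (lindbladian (wmlOp d)) Δ (ρ ⊗ₖ programState L))
  map_add' ρ σ := by
    rw [Matrix.add_kronecker, map_add]
    ext i j
    simp [partialTrace, Finset.sum_add_distrib]
  map_smul' c ρ := by
    rw [Matrix.smul_kronecker, map_smul]
    ext i j
    simp [partialTrace, Finset.mul_sum]

end WML

end

/-! The argument runs in the Heisenberg picture: trace-norm bounds on maps follow from operator-norm
bounds on their trace duals. By `idTensor_lindbladian` an amplified Lindbladian is again a
Lindbladian, with operator `I ⊗ K`, so bounds depending only on `‖K‖` are uniform in the reference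
system and control the diamond norm.

With `V = I ⊗ |ψ_L⟩`, an isometry exactly because `‖L‖₂ = 1`, the dual of one step is `Y ↦ V†
e^{Δ𝓜†}(Y ⊗ I) V`. The identity `M V = W L`, where `W` appends the maximally entangled unit vector,
makes the compression of `𝓜†` equal to `𝓛†` (`ancillaDual_adjointLindbladian`). The step and
`e^{Δ𝓛†}` thus agree to first order in `Δ`. Each generator has norm at most `2d`, since `‖L‖² ≤ ‖M‖²
≤ d`, so each remainder is at most `e^x - 1 - x ≤ (13/18) x²` with `x = 2dΔ ≤ 1`.

Both duals are contractions (`norm_exp_adjointLindbladian_le_one`), so the errors of `n` steps only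
add up (`norm_pow_sub_pow_le`): the total is at most `n · 2 · (13/18)(2dt/n)² = (52/9) t²d²/n`. Half
of this is below `3t²d²/n`. -/

open scoped Matrix.Norms.L2Operator

namespace WML

/-! ### Exponentials in Banach algebras -/

section BanachAlgebra

variable {A : Type*} [NormedRing A] [NormedAlgebra ℂ A] [CompleteSpace A]

theorem norm_exp_sub_one_sub_le (x : A) :
    ‖NormedSpace.exp x - 1 - x‖ ≤ Real.exp ‖x‖ - 1 - ‖x‖ := by
  have h1 : HasSum (fun k : ℕ => ((k + 2) !⁻¹ : ℂ) • x ^ (k + 2)) (NormedSpace.exp x - 1 - x) := by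
    have := (hasSum_nat_add_iff' 2).2 (NormedSpace.exp_series_hasSum_exp' (𝕂 := ℂ) x)
    simpa [Finset.sum_range_succ, sub_sub] using this
  have h2 : HasSum (fun k : ℕ => ((k + 2) !⁻¹ : ℝ) • ‖x‖ ^ (k + 2))
      (Real.exp ‖x‖ - 1 - ‖x‖) := by
    have := (hasSum_nat_add_iff' 2).2 (NormedSpace.exp_series_hasSum_exp' (𝕂 := ℝ) ‖x‖)
    rw [← Real.exp_eq_exp_ℝ] at this
    simpa [Finset.sum_range_succ, sub_sub] using this
  rw [← h1.tsum_eq]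
  refine tsum_of_norm_bounded h2 fun k => ?_
  refine (norm_smul_le _ _).trans ?_
  have : ‖((k + 2) !⁻¹ : ℂ)‖ = ((k + 2) !⁻¹ : ℝ) := by simp
  rw [this, smul_eq_mul]
  exact mul_le_mul_of_nonneg_left (norm_pow_le' x (by omega)) (by positivity)

theorem exp_smul_eq_pow (G : A) (t : ℝ) {n : ℕ} (hn : n ≠ 0) :
    NormedSpace.exp ((t : ℂ) • G) = NormedSpace.exp (((t / n : ℝ) : ℂ) • G) ^ n := by
  let +nondep : NormedAlgebra ℚ A := .restrictScalars ℚ ℂ A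
  have h : (t : ℂ) • G = n • (((t / n : ℝ) : ℂ) • G) := by
    rw [← Nat.cast_smul_eq_nsmul ℂ, smul_smul]
    congr 1
    push_cast
    field_simp
  rw [h, NormedSpace.exp_nsmul]

/-- Since `exp(tG) = exp(tG/N)^N` and each factor has norm `1 + O(1/N²)`, the product is bounded by
`1 + O(1/N)`; let `N → ∞`. Dissipativity of `G` is needed only up to second order. -/
theorem norm_exp_le_one_of_norm_one_add_smul_le [NormOneClass A] {G : A} {C : ℝ}
    (h : ∀ s : ℝ, 0 ≤ s → ‖1 + (s : ℂ) • G‖ ≤ 1 + C * s ^ 2) {t : ℝ} (ht : 0 ≤ t) :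
    ‖NormedSpace.exp ((t : ℂ) • G)‖ ≤ 1 := by
  have key : ∀ᶠ N : ℕ in Filter.atTop,
      ‖NormedSpace.exp ((t : ℂ) • G)‖ ≤ Real.exp ((C + ‖G‖ ^ 2) * t ^ 2 * (1 / (N : ℝ))) := by
    -- Taking `N ≥ t‖G‖` gives `x = ‖tG/N‖ ≤ 1`, where `e^x - 1 - x ≤ x²`.
    filter_upwards [Filter.eventually_ge_atTop (Nat.ceil (t * ‖G‖)), Filter.eventually_gt_atTop 0]
      with N hN hN0
    have hN0' : (0 : ℝ) < N := by exact_mod_cast hN0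
    have hs : 0 ≤ t / N := by positivity
    have hsG : ‖((t / N : ℝ) : ℂ) • G‖ = t / N * ‖G‖ := by
      rw [norm_smul, Complex.norm_real, Real.norm_of_nonneg hs]
    have hle : t / N * ‖G‖ ≤ 1 := by
      rw [div_mul_eq_mul_div, div_le_one hN0']
      exact (Nat.le_ceil _).trans (by exact_mod_cast hN)
    have h1 : ‖NormedSpace.exp (((t / N : ℝ) : ℂ) • G)‖ ≤
        1 + (C + ‖G‖ ^ 2) * (t / N) ^ 2 := by
      have e := norm_exp_sub_one_sub_le (((t / N : ℝ) : ℂ) • G)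
      rw [hsG] at e
      have e2 := Real.abs_exp_sub_one_sub_id_le (x := t / N * ‖G‖)
        (by rwa [abs_of_nonneg (by positivity)])
      have e3 := (le_abs_self _).trans e2
      have e4 : NormedSpace.exp (((t / N : ℝ) : ℂ) • G) =
          (1 + ((t / N : ℝ) : ℂ) • G) +
            (NormedSpace.exp (((t / N : ℝ) : ℂ) • G) - 1 - ((t / N : ℝ) : ℂ) • G) := by abel
      rw [e4]
      refine (norm_add_le _ _).trans ?_
      have := h _ hs
      nlinarith
    rw [exp_smul_eq_pow G t hN0.ne']
    calc _ ≤ ‖NormedSpace.exp (((t / N : ℝ) : ℂ) • G)‖ ^ N := norm_pow_le _ _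
      _ ≤ (1 + (C + ‖G‖ ^ 2) * (t / N) ^ 2) ^ N := by gcongr
      _ ≤ (Real.exp ((C + ‖G‖ ^ 2) * (t / N) ^ 2)) ^ N := by
          gcongr
          · exact (norm_nonneg _).trans h1
          · rw [add_comm]; exact Real.add_one_le_exp _
      _ = _ := by
          rw [← Real.exp_nat_mul]
          congr 1
          field_simp
  have lim : Filter.Tendsto
      (fun N : ℕ => Real.exp ((C + ‖G‖ ^ 2) * t ^ 2 * (1 / (N : ℝ)))) Filter.atTop (nhds 1) := by
    have := ((Real.continuous_exp.tendsto _).comp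
      ((tendsto_one_div_atTop_nhds_zero_nat (𝕜 := ℝ)).const_mul ((C + ‖G‖ ^ 2) * t ^ 2)))
    simpa [Function.comp_def] using this
  exact ge_of_tendsto lim key

/-- Telescoping: contractions do not amplify the errors of earlier steps. -/
theorem norm_pow_sub_pow_le {R : Type*} [NormedRing R] [NormOneClass R] {a b : R}
    (ha : ‖a‖ ≤ 1) (hb : ‖b‖ ≤ 1) (n : ℕ) : ‖a ^ n - b ^ n‖ ≤ n * ‖a - b‖ := by
  induction n with
  | zero => simp
  | succ n ih =>
    have e : a ^ (n + 1) - b ^ (n + 1) = (a ^ n - b ^ n) * a + b ^ n * (a - b) := by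
      rw [pow_succ, pow_succ]; noncomm_ring
    rw [e]
    refine (norm_add_le _ _).trans ?_
    have h1 : ‖(a ^ n - b ^ n) * a‖ ≤ n * ‖a - b‖ :=
      (norm_mul_le _ _).trans ((mul_le_of_le_one_right (norm_nonneg _) ha).trans ih)
    have h2 : ‖b ^ n * (a - b)‖ ≤ ‖a - b‖ :=
      (norm_mul_le _ _).trans (mul_le_of_le_one_left (norm_nonneg _)
        ((norm_pow_le _ _).trans (pow_le_one₀ (norm_nonneg _) hb)))
    push_cast
    linarith

/-- The third-order Taylor bound gives `x²/2 + (2/9)x³`, and `x³ ≤ x²` on `[0, 1]`, whence `1/2 +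
2/9 = 13/18`. -/
theorem exp_sub_one_sub_le {x : ℝ} (h0 : 0 ≤ x) (h1 : x ≤ 1) :
    Real.exp x - 1 - x ≤ 13 / 18 * x ^ 2 := by
  have := Real.exp_bound' h0 h1 (n := 3) (by norm_num)
  simp [Finset.sum_range_succ, Nat.factorial] at this
  nlinarith [pow_nonneg h0 2]

end BanachAlgebra

/-! ### Trace norm and its duality with the operator norm -/

section TraceNorm

variable {n : Type*} [Fintype n] [DecidableEq n]

/-- The trace norm is attained at the polar-decomposition test matrix `Y = X† (XX†)^{-1/2}`, which
has norm at most 1. -/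
theorem schattenNorm_one_le {X : Matrix n n ℂ} {c : ℝ} (hc : 0 ≤ c)
    (h : ∀ Y : Matrix n n ℂ, ‖(Y * X).trace‖ ≤ c * ‖Y‖) : schattenNorm 1 X ≤ c := by
  set P := X * Xᴴ with hP
  have hP0 : 0 ≤ P := (Matrix.posSemidef_self_mul_conjTranspose X).nonneg
  have hsa : IsSelfAdjoint P := IsSelfAdjoint.of_nonneg hP0
  -- The spectrum is finite, so even the discontinuous `(√x)⁻¹` is admissible in the functional
  -- calculus. As `0⁻¹ = 0`, the matrix `Q` below is a pseudo-inverse square root, and no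
  -- invertibility is required.
  have cont : ∀ f : ℝ → ℝ, ContinuousOn f (spectrum ℝ P) := fun f =>
    (Matrix.finite_real_spectrum (A := P)).continuousOn f
  have hnn : ∀ x ∈ spectrum ℝ P, 0 ≤ x := fun x hx => spectrum_nonneg_of_nonneg hP0 hx
  set Q := cfc (fun x : ℝ => (√x)⁻¹) P with hQ
  have hQs : Qᴴ = Q := (cfc_predicate (R := ℝ) (p := IsSelfAdjoint) _ P)
  have hQPQ : Q * P * Q = cfc (fun x : ℝ => (√x)⁻¹ * x * (√x)⁻¹) P := by
    rw [cfc_mul _ _ P (cont _) (cont _), cfc_mul _ _ P (cont _) (cont _), cfc_id' ℝ P]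
  have hPQ : P * Q = CFC.rpow P (1 / 2) := by
    rw [show CFC.rpow P (1 / 2) = P ^ (1 / 2 : ℝ) from rfl, CFC.rpow_eq_cfc_real]
    nth_rw 1 [← cfc_id' ℝ P]
    rw [hQ, ← cfc_mul _ _ P (cont _) (cont _)]
    refine cfc_congr fun x hx => ?_
    have h0 := hnn x hx
    rw [← Real.sqrt_eq_rpow, ← div_eq_mul_inv, Real.div_sqrt]
  have hnorm : ‖Xᴴ * Q‖ ≤ 1 := by
    have h1 : ‖(Xᴴ * Q)ᴴ * (Xᴴ * Q)‖ ≤ 1 := by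
      rw [conjTranspose_mul, conjTranspose_conjTranspose, hQs]
      rw [show Q * X * (Xᴴ * Q) = Q * P * Q by rw [hP]; simp only [Matrix.mul_assoc], hQPQ]
      refine norm_cfc_le zero_le_one fun x hx => ?_
      have h0 := hnn x hx
      rcases h0.eq_or_lt with h0 | h0
      · simp [← h0]
      · have : (√x)⁻¹ * x * (√x)⁻¹ = 1 := by
          have := Real.sqrt_pos.2 h0
          field_simp
          rw [Real.sq_sqrt h0.le]
        simp [this]
    rw [Matrix.l2_opNorm_conjTranspose_mul_self] at h1
    nlinarith [norm_nonneg (Xᴴ * Q)]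
  have ht := h (Xᴴ * Q)
  have e : (Xᴴ * Q * X).trace = (P * Q).trace := by
    rw [Matrix.trace_mul_comm, ← Matrix.mul_assoc]
  rw [schattenNorm, div_one, Real.rpow_one, ← hP, ← hPQ]
  calc (P * Q).trace.re ≤ ‖(P * Q).trace‖ := Complex.re_le_norm _
    _ ≤ c * ‖Xᴴ * Q‖ := by rw [← e]; exact ht
    _ ≤ c := mul_le_of_le_one_right hc hnorm

theorem IsDensity.norm_trace_mul_le {ρ : Matrix n n ℂ} (hρ : IsDensity ρ) (Y : Matrix n n ℂ) :
    ‖(Y * ρ).trace‖ ≤ ‖Y‖ := by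
  obtain ⟨B, rfl⟩ := CStarAlgebra.nonneg_iff_eq_star_mul_self.1 hρ.1.nonneg
  rw [Matrix.star_eq_conjTranspose] at hρ ⊢
  have htr := hρ.2
  -- With `ρ = B†B`, the conjugated rows of `B` decompose `ρ` into rank-one terms whose squared
  -- norms sum to `Tr ρ = 1`.
  let v : n → EuclideanSpace ℂ n := fun i => WithLp.toLp 2 (star (B i))
  have h1 : (Y * (Bᴴ * B)).trace = ∑ i, inner ℂ (v i) (Matrix.toEuclideanCLM (𝕜 := ℂ) Y (v i)) := by
    rw [← Matrix.mul_assoc, Matrix.trace_mul_comm, Matrix.trace]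
    refine Finset.sum_congr rfl fun i _ => ?_
    simp only [v, Matrix.toEuclideanCLM_toLp, EuclideanSpace.inner_eq_star_dotProduct, diag_apply,
      star_star]
    rw [dotProduct_comm]
    rfl
  have h2 : ∑ i, ‖v i‖ ^ 2 = 1 := by
    have : ((∑ i, ‖v i‖ ^ 2 : ℝ) : ℂ) = 1 := by
      rw [← htr, Matrix.trace_mul_comm, Matrix.trace]
      push_cast
      refine Finset.sum_congr rfl fun i _ => ?_
      have := inner_self_eq_norm_sq_to_K (𝕜 := ℂ) (v i)
      rw [← RCLike.ofReal_eq_complex_ofReal, ← this]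
      simp only [v, EuclideanSpace.inner_eq_star_dotProduct, star_star, diag_apply]
      rw [dotProduct_comm]
      rfl
    exact_mod_cast this
  rw [h1]
  calc _ ≤ ∑ i, ‖inner ℂ (v i) (Matrix.toEuclideanCLM (𝕜 := ℂ) Y (v i))‖ := norm_sum_le _ _
    _ ≤ ∑ i, ‖Y‖ * ‖v i‖ ^ 2 := by
        refine Finset.sum_le_sum fun i _ => (norm_inner_le_norm _ _).trans ?_
        have := (Matrix.toEuclideanCLM (𝕜 := ℂ) Y).le_opNorm (v i)
        rw [← Matrix.cstar_norm_def] at this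
        nlinarith [norm_nonneg (v i)]
    _ = ‖Y‖ := by rw [← Finset.mul_sum, h2, mul_one]

theorem sum_normSq_of_schattenNorm_two {X : Matrix n n ℂ} (hX : schattenNorm 2 X = 1) :
    ∑ i, ∑ j, X i j * star (X i j) = 1 := by
  have hP0 : 0 ≤ X * Xᴴ := (Matrix.posSemidef_self_mul_conjTranspose X).nonneg
  have hr : CFC.rpow (X * Xᴴ) (2 / 2) = X * Xᴴ := by
    rw [div_self two_ne_zero]; exact CFC.rpow_one _
  have htr : (X * Xᴴ).trace = ∑ i, ∑ j, X i j * star (X i j) := by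
    simp [Matrix.trace, Matrix.mul_apply]
  rw [schattenNorm, hr] at hX
  have h0 := (Matrix.posSemidef_self_mul_conjTranspose X).trace_nonneg
  rw [Complex.nonneg_iff] at h0
  rw [← Real.sqrt_eq_rpow, Real.sqrt_eq_one] at hX
  rw [← htr]
  exact Complex.ext hX h0.2.symm

end TraceNorm

end WML

namespace WML

/-! ### Amplifications and completely positive maps -/

section Amplification

variable {n m r : Type*} [Fintype n] [DecidableEq n] [Fintype m] [DecidableEq m]
  [Fintype r] [DecidableEq r]

/-- The amplification `Y ↦ I ⊗ Y`. -/
def ampLeft (r : Type*) [Fintype r] [DecidableEq r] :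
    Matrix n n ℂ →⋆ₐ[ℂ] Matrix (r × n) (r × n) ℂ where
  toFun Y := (1 : Matrix r r ℂ) ⊗ₖ Y
  map_one' := Matrix.one_kronecker_one
  map_mul' X Y := by rw [← Matrix.mul_kronecker_mul, Matrix.one_mul]
  map_zero' := Matrix.kronecker_zero _
  map_add' X Y := Matrix.kronecker_add _ _ _
  commutes' c := by
    rw [Algebra.algebraMap_eq_smul_one, Algebra.algebraMap_eq_smul_one, Matrix.kronecker_smul,
      Matrix.one_kronecker_one]
  map_star' Y := by
    simp [Matrix.star_eq_conjTranspose, Matrix.conjTranspose_kronecker]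

/-- The amplification `Y ↦ Y ⊗ I`, for `Y` acting on a tensor product `R ⊗ S`. -/
def ampRight (m : Type*) [Fintype m] [DecidableEq m] :
    Matrix (r × n) (r × n) ℂ →⋆ₐ[ℂ] Matrix (r × (n × m)) (r × (n × m)) ℂ where
  toFun Y := (Y ⊗ₖ (1 : Matrix m m ℂ)).submatrix (Equiv.prodAssoc r n m).symm
    (Equiv.prodAssoc r n m).symm
  map_one' := by rw [Matrix.one_kronecker_one, Matrix.submatrix_one_equiv]
  map_mul' X Y := by
    rw [Matrix.submatrix_mul_equiv, ← Matrix.mul_kronecker_mul, Matrix.one_mul]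
  map_zero' := by rw [Matrix.zero_kronecker]; rfl
  map_add' X Y := by rw [Matrix.add_kronecker]; rfl
  commutes' c := by
    rw [Algebra.algebraMap_eq_smul_one, Algebra.algebraMap_eq_smul_one, Matrix.smul_kronecker,
      Matrix.one_kronecker_one, Matrix.submatrix_smul, Pi.smul_apply, Pi.smul_apply,
      Matrix.submatrix_one_equiv]
  map_star' Y := by
    simp [Matrix.star_eq_conjTranspose, Matrix.conjTranspose_submatrix,
      Matrix.conjTranspose_kronecker]

theorem ampLeft_apply (Y : Matrix n n ℂ) : ampLeft r Y = (1 : Matrix r r ℂ) ⊗ₖ Y := rfl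

theorem ampRight_apply (Y : Matrix (r × n) (r × n) ℂ) (p q : r × (n × m)) :
    ampRight m Y p q = if p.2.2 = q.2.2 then Y (p.1, p.2.1) (q.1, q.2.1) else 0 := by
  change Y (p.1, p.2.1) (q.1, q.2.1) * (1 : Matrix m m ℂ) p.2.2 q.2.2 = _
  simp [Matrix.one_apply]

theorem norm_ampLeft_le (Y : Matrix n n ℂ) : ‖ampLeft r Y‖ ≤ ‖Y‖ :=
  NonUnitalStarAlgHom.norm_apply_le _ _

theorem norm_ampRight_le (Y : Matrix (r × n) (r × n) ℂ) : ‖ampRight m Y‖ ≤ ‖Y‖ :=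
  NonUnitalStarAlgHom.norm_apply_le _ _

/-- Only an inequality, because the index type may be empty. -/
theorem norm_one_le_one : ‖(1 : Matrix n n ℂ)‖ ≤ 1 := by
  rw [← Matrix.diagonal_one, Matrix.l2_opNorm_diagonal]
  exact (pi_norm_le_iff_of_nonneg zero_le_one).2 fun i => by simp

omit [DecidableEq m] in
theorem norm_le_sqrt_of_conjTranspose_mul_self {V : Matrix m n ℂ} {c : ℝ} (hc : 0 ≤ c)
    (hV : Vᴴ * V = (c : ℂ) • (1 : Matrix n n ℂ)) : ‖V‖ ≤ √c := by
  apply Real.le_sqrt_of_sq_le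
  rw [sq, ← Matrix.l2_opNorm_conjTranspose_mul_self, hV, norm_smul, Complex.norm_real,
    Real.norm_of_nonneg hc]
  exact mul_le_of_le_one_right hc norm_one_le_one

omit [DecidableEq m] in
theorem norm_le_one_of_isometry {V : Matrix m n ℂ} (hV : Vᴴ * V = 1) : ‖V‖ ≤ 1 := by
  simpa using norm_le_sqrt_of_conjTranspose_mul_self zero_le_one (V := V) (by simpa using hV)

theorem norm_conj_mul_conj_le {V : Matrix m n ℂ} (Y : Matrix m m ℂ) :
    ‖Vᴴ * Y * V‖ ≤ ‖V‖ ^ 2 * ‖Y‖ := by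
  have h1 := (Matrix.l2_opNorm_mul (Vᴴ * Y) V)
  have h2 := Matrix.l2_opNorm_mul Vᴴ Y
  rw [Matrix.l2_opNorm_conjTranspose] at h2
  nlinarith [norm_nonneg V]

/-- A completely positive map with two Kraus operators is bounded by its value at `1`. -/
theorem norm_kraus_pair_le (A B Y : Matrix n n ℂ) :
    ‖Aᴴ * Y * A + Bᴴ * Y * B‖ ≤ ‖Aᴴ * A + Bᴴ * B‖ * ‖Y‖ := by
  -- Stinespring form: stacking `A` over `B` turns the map into `Y ↦ V†(I ⊗ Y)V`, and `‖V‖² =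
  -- ‖V†V‖`.
  let V : Matrix (Fin 2 × n) n ℂ := Matrix.of fun p j => (![A, B] p.1) p.2 j
  have h : ∀ Y : Matrix n n ℂ, Vᴴ * ampLeft (Fin 2) Y * V = Aᴴ * Y * A + Bᴴ * Y * B := by
    intro Y
    ext i j
    simp [Matrix.mul_apply, Fintype.sum_prod_type, V, ampLeft_apply, Matrix.one_apply,
      Matrix.conjTranspose_apply, Finset.sum_mul]
  have h1 : Vᴴ * V = Aᴴ * A + Bᴴ * B := by simpa using h 1
  rw [← h Y, ← h1, Matrix.l2_opNorm_conjTranspose_mul_self, ← sq]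
  exact (norm_conj_mul_conj_le _).trans
    (mul_le_mul_of_nonneg_left (norm_ampLeft_le _) (sq_nonneg _))

end Amplification

/-! ### Heisenberg-picture Lindbladians and contractivity -/

section AdjointLindbladian

variable {n : Type*} [Fintype n] [DecidableEq n]

/-- The generator `Y ↦ K†YK - ½{K†K, Y}` of the Heisenberg picture. -/
noncomputable def adjointLindbladian (K : Matrix n n ℂ) : Matrix n n ℂ →L[ℂ] Matrix n n ℂ :=
  LinearMap.toContinuousLinearMap
    { toFun := fun Y => Kᴴ * Y * K - (1 / 2 : ℂ) • (Kᴴ * K * Y + Y * (Kᴴ * K))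
      map_add' := fun X Y => by
        simp only [Matrix.mul_add, Matrix.add_mul, smul_add]
        abel
      map_smul' := fun c X => by
        simp only [Matrix.mul_smul, Matrix.smul_mul, RingHom.id_apply, smul_sub, smul_add,
          smul_comm c (1 / 2 : ℂ)] }

omit [DecidableEq n] in
theorem adjointLindbladian_apply (K Y : Matrix n n ℂ) :
    adjointLindbladian K Y = Kᴴ * Y * K - (1 / 2 : ℂ) • (Kᴴ * K * Y + Y * (Kᴴ * K)) := rfl

omit [DecidableEq n] in
theorem trace_mul_lindbladian (K X Y : Matrix n n ℂ) :
    (Y * lindbladian K X).trace = (adjointLindbladian K Y * X).trace := by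
  have h1 : (Y * (K * X * Kᴴ)).trace = (Kᴴ * Y * K * X).trace := by
    rw [← Matrix.mul_assoc, Matrix.trace_mul_comm]; simp only [Matrix.mul_assoc]
  have h2 : (Y * (X * (Kᴴ * K))).trace = (Kᴴ * K * Y * X).trace := by
    rw [← Matrix.mul_assoc, Matrix.trace_mul_comm]; simp only [Matrix.mul_assoc]
  rw [adjointLindbladian_apply]
  change (Y * (K * X * Kᴴ - (1 / 2 : ℂ) • (Kᴴ * K * X + X * (Kᴴ * K)))).trace = _
  simp only [Matrix.mul_sub, Matrix.mul_smul, Matrix.mul_add, Matrix.sub_mul, Matrix.smul_mul,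
    Matrix.add_mul, Matrix.trace_sub, Matrix.trace_smul, Matrix.trace_add, h1, h2]
  simp only [Matrix.mul_assoc, add_comm]

theorem norm_adjointLindbladian_le (K : Matrix n n ℂ) : ‖adjointLindbladian K‖ ≤ 2 * ‖K‖ ^ 2 := by
  refine ContinuousLinearMap.opNorm_le_bound _ (by positivity) fun Y => ?_
  rw [adjointLindbladian_apply]
  have hH : ‖Kᴴ * K‖ = ‖K‖ ^ 2 := by rw [Matrix.l2_opNorm_conjTranspose_mul_self, sq]
  have h1 := norm_conj_mul_conj_le (V := K) Y
  have h2 := norm_mul_le (Kᴴ * K) Y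
  have h3 := norm_mul_le Y (Kᴴ * K)
  rw [hH] at h2 h3
  have h4 := norm_add_le (Kᴴ * K * Y) (Y * (Kᴴ * K))
  have h5 := norm_sub_le (Kᴴ * Y * K) ((1 / 2 : ℂ) • (Kᴴ * K * Y + Y * (Kᴴ * K)))
  rw [norm_smul, show ‖(1 / 2 : ℂ)‖ = 1 / 2 by norm_num] at h5
  nlinarith

/-- Up to `s²/4 · HYH`, the map is completely positive with Kraus operators `1 - (s/2)H` and `√s K`.
It sends `1` to `1 + (s²/4)H²`, because the first-order terms cancel. The two errors, each at most
`s²‖K‖⁴/4`, make up the constant. -/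
theorem norm_one_add_smul_adjointLindbladian_le (K : Matrix n n ℂ) {s : ℝ} (hs : 0 ≤ s) :
    ‖1 + (s : ℂ) • adjointLindbladian K‖ ≤ 1 + ‖K‖ ^ 4 / 2 * s ^ 2 := by
  refine ContinuousLinearMap.opNorm_le_bound _ (by positivity) fun Y => ?_
  set H := Kᴴ * K with hH
  have hHs : Hᴴ = H := by simp [hH]
  have hHn : ‖H‖ = ‖K‖ ^ 2 := by rw [Matrix.l2_opNorm_conjTranspose_mul_self, sq]
  let A : Matrix n n ℂ := 1 - ((s / 2 : ℝ) : ℂ) • H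
  let B : Matrix n n ℂ := ((√s : ℝ) : ℂ) • K
  have hss : ((√s : ℝ) : ℂ) * ((√s : ℝ) : ℂ) = s := by
    rw [← Complex.ofReal_mul, Real.mul_self_sqrt hs]
  have hA : Aᴴ = A := by simp [A, hHs]
  have hBY : ∀ Y : Matrix n n ℂ, Bᴴ * Y * B = (s : ℂ) • (Kᴴ * Y * K) := by
    intro Y
    simp only [B, Matrix.conjTranspose_smul, Matrix.smul_mul, Matrix.mul_smul, smul_smul]
    rw [show star ((√s : ℝ) : ℂ) = ((√s : ℝ) : ℂ) from Complex.conj_ofReal _, hss]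
  have e1 : Aᴴ * A + Bᴴ * B = 1 + ((s ^ 2 / 4 : ℝ) : ℂ) • (H * H) := by
    have := hBY 1
    rw [Matrix.mul_one, Matrix.mul_one, ← hH] at this
    rw [this, hA]
    simp only [A, Matrix.sub_mul, Matrix.mul_sub, Matrix.one_mul, Matrix.mul_one, Matrix.smul_mul,
      Matrix.mul_smul]
    push_cast
    module
  have e2 : (1 + (s : ℂ) • adjointLindbladian K) Y =
      (Aᴴ * Y * A + Bᴴ * Y * B) - ((s ^ 2 / 4 : ℝ) : ℂ) • (H * Y * H) := by
    rw [hBY, hA]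
    change Y + (s : ℂ) • adjointLindbladian K Y = _
    rw [adjointLindbladian_apply, ← hH]
    simp only [A, Matrix.sub_mul, Matrix.mul_sub, Matrix.one_mul, Matrix.mul_one, Matrix.smul_mul,
      Matrix.mul_smul]
    push_cast
    module
  have hsn : ‖((s ^ 2 / 4 : ℝ) : ℂ)‖ = s ^ 2 / 4 := by
    rw [Complex.norm_real, Real.norm_of_nonneg (by positivity)]
  have h1 : ‖Aᴴ * A + Bᴴ * B‖ ≤ 1 + s ^ 2 / 4 * ‖K‖ ^ 4 := by
    rw [e1]
    refine (norm_add_le _ _).trans (add_le_add norm_one_le_one ?_)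
    rw [norm_smul, hsn]
    refine mul_le_mul_of_nonneg_left ?_ (by positivity)
    calc ‖H * H‖ ≤ ‖H‖ * ‖H‖ := norm_mul_le _ _
      _ = ‖K‖ ^ 4 := by rw [hHn]; ring
  have h2 : ‖((s ^ 2 / 4 : ℝ) : ℂ) • (H * Y * H)‖ ≤ s ^ 2 / 4 * ‖K‖ ^ 4 * ‖Y‖ := by
    rw [norm_smul, hsn, mul_assoc (s ^ 2 / 4)]
    refine mul_le_mul_of_nonneg_left ?_ (by positivity)
    have h := norm_conj_mul_conj_le (V := H) Y
    rw [hHs, hHn, ← pow_mul] at h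
    exact h
  rw [e2]
  refine (norm_sub_le _ _).trans ?_
  have h3 := (norm_kraus_pair_le A B Y).trans (mul_le_mul_of_nonneg_right h1 (norm_nonneg Y))
  linarith

theorem norm_exp_adjointLindbladian_le_one [Nonempty n] (K : Matrix n n ℂ) {t : ℝ} (ht : 0 ≤ t) :
    ‖NormedSpace.exp ((t : ℂ) • adjointLindbladian K)‖ ≤ 1 :=
  norm_exp_le_one_of_norm_one_add_smul_le (A := Matrix n n ℂ →L[ℂ] Matrix n n ℂ)
    (fun _ hs => norm_one_add_smul_adjointLindbladian_le K hs) ht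

theorem norm_exp_adjointLindbladian_sub_le (K : Matrix n n ℂ) {t c : ℝ} (ht : 0 ≤ t)
    (hK : ‖K‖ ^ 2 ≤ c) (hc : 2 * c * t ≤ 1) :
    ‖NormedSpace.exp ((t : ℂ) • adjointLindbladian K) - 1 - (t : ℂ) • adjointLindbladian K‖ ≤
      13 / 18 * (2 * c * t) ^ 2 := by
  refine (norm_exp_sub_one_sub_le (A := Matrix n n ℂ →L[ℂ] Matrix n n ℂ) _).trans ?_
  have h : ‖(t : ℂ) • adjointLindbladian K‖ ≤ 2 * c * t := by
    rw [norm_smul, Complex.norm_real, Real.norm_of_nonneg ht]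
    have := norm_adjointLindbladian_le K
    nlinarith
  refine (exp_sub_one_sub_le (norm_nonneg _) (h.trans hc)).trans ?_
  gcongr

end AdjointLindbladian

end WML

namespace WML

/-! ### Trace duality for semigroups and amplified maps -/

section Duality

variable {n r : Type*} [Fintype n] [DecidableEq n] [Fintype r] [DecidableEq r]

omit [DecidableEq n] in
theorem hasSum_semigroup (A : Module.End ℂ (Matrix n n ℂ)) (t : ℝ) (X : Matrix n n ℂ) :
    HasSum (fun k : ℕ => ((t : ℂ) ^ k / (k ! : ℂ)) • (A ^ k) X) (semigroup A t X) :=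
  (summable_semigroup A t X).hasSum

omit [DecidableEq n] in
theorem trace_mul_pow {A : Module.End ℂ (Matrix n n ℂ)} {G : Matrix n n ℂ →L[ℂ] Matrix n n ℂ}
    (h : ∀ X Y, (Y * A X).trace = (G Y * X).trace) (k : ℕ) (X Y : Matrix n n ℂ) :
    (Y * (A ^ k) X).trace = ((G ^ k) Y * X).trace := by
  induction k generalizing X with
  | zero => rfl
  | succ k ih => rw [pow_succ, Module.End.mul_apply, ih, h, pow_succ']; rfl

theorem smul_pow_apply {E : Type*} [NormedAddCommGroup E] [NormedSpace ℂ E] (c : ℂ)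
    (G : E →L[ℂ] E) (k : ℕ) (Y : E) : ((c • G) ^ k) Y = c ^ k • (G ^ k) Y := by
  induction k generalizing Y with
  | zero => simp
  | succ k ih =>
    rw [pow_succ, pow_succ, pow_succ]
    change ((c • G) ^ k) (c • G Y) = _
    rw [ih, map_smul, smul_smul]
    rfl

/-- The exponential of the dual of a linear map is the dual of its semigroup. -/
theorem trace_mul_semigroup {A : Module.End ℂ (Matrix n n ℂ)}
    {G : Matrix n n ℂ →L[ℂ] Matrix n n ℂ} (h : ∀ X Y, (Y * A X).trace = (G Y * X).trace) (t : ℝ)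
    (X Y : Matrix n n ℂ) :
    (Y * semigroup A t X).trace = (NormedSpace.exp ((t : ℂ) • G) Y * X).trace := by
  have h1 : HasSum (fun k : ℕ => (Y * (((t : ℂ) ^ k / (k ! : ℂ)) • (A ^ k) X)).trace)
      (Y * semigroup A t X).trace :=
    (hasSum_semigroup A t X).map ((Matrix.traceAddMonoidHom n ℂ).comp (AddMonoidHom.mulLeft Y))
      (continuous_const.matrix_mul continuous_id).matrix_trace
  have h2 : HasSum (fun k : ℕ => (((k !⁻¹ : ℂ) • ((t : ℂ) • G) ^ k) Y * X).trace)
      (NormedSpace.exp ((t : ℂ) • G) Y * X).trace :=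
    (NormedSpace.exp_series_hasSum_exp' (𝕂 := ℂ) ((t : ℂ) • G)).map
      ((Matrix.traceAddMonoidHom n ℂ).comp ((AddMonoidHom.mulRight X).comp
        (ContinuousLinearMap.apply ℂ (Matrix n n ℂ) Y).toLinearMap.toAddMonoidHom))
      (((ContinuousLinearMap.apply ℂ (Matrix n n ℂ) Y).continuous.matrix_mul
        continuous_const).matrix_trace)
  refine h1.unique ?_
  convert h2 using 2 with k
  rw [_root_.smul_apply, smul_pow_apply, smul_smul, Matrix.mul_smul, Matrix.smul_mul,
    Matrix.trace_smul, Matrix.trace_smul, trace_mul_pow h, div_eq_inv_mul]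

omit [Fintype n] [DecidableEq n] [Fintype r] [DecidableEq r] in
theorem idTensor_mul (A B : Module.End ℂ (Matrix n n ℂ)) :
    idTensor r (A * B) = idTensor r A * idTensor r B := rfl

omit [Fintype n] [DecidableEq n] [Fintype r] [DecidableEq r] in
theorem idTensor_pow (A : Module.End ℂ (Matrix n n ℂ)) (k : ℕ) :
    idTensor r (A ^ k) = idTensor r A ^ k := by
  induction k with
  | zero => rfl
  | succ k ih => rw [pow_succ, pow_succ, idTensor_mul, ih]

omit [DecidableEq n] [DecidableEq r] in
theorem idTensor_semigroup (A : Module.End ℂ (Matrix n n ℂ)) (t : ℝ) :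
    idTensor r (semigroup A t) = semigroup (idTensor r A) t := by
  refine LinearMap.ext fun X => Matrix.ext fun p q => ?_
  have h1 := ((hasSum_semigroup (idTensor r A) t X).map (Matrix.entryAddMonoidHom ℂ p q)
    (continuous_id.matrix_elem p q))
  have h2 := ((hasSum_semigroup A t (Matrix.of fun a b => X (p.1, a) (q.1, b))).map
    (Matrix.entryAddMonoidHom ℂ p.2 q.2) (continuous_id.matrix_elem p.2 q.2))
  refine h2.unique ?_
  simp only [Function.comp_def, ← idTensor_pow] at h1
  exact h1

/-- Left and right multiplication by `I ⊗ B` act separately on each block of `X`. -/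
theorem idTensor_lindbladian (K : Matrix n n ℂ) :
    idTensor r (lindbladian K) = lindbladian (ampLeft r K) := by
  refine LinearMap.ext fun X => Matrix.ext fun p q => ?_
  have hl : ∀ (B : Matrix n n ℂ) (X : Matrix (r × n) (r × n) ℂ) (i j : r),
      (Matrix.of fun a b => (ampLeft r B * X) (i, a) (j, b)) =
        B * Matrix.of fun a b => X (i, a) (j, b) := by
    intro B X i j
    ext a b
    simp [Matrix.mul_apply, Fintype.sum_prod_type, ampLeft_apply, Matrix.one_apply]
  have hr : ∀ (B : Matrix n n ℂ) (X : Matrix (r × n) (r × n) ℂ) (i j : r),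
      (Matrix.of fun a b => (X * ampLeft r B) (i, a) (j, b)) =
        (Matrix.of fun a b => X (i, a) (j, b)) * B := by
    intro B X i j
    ext a b
    simp [Matrix.mul_apply, Fintype.sum_prod_type, ampLeft_apply, Matrix.one_apply]
  have hs : (ampLeft r K)ᴴ = ampLeft r Kᴴ := (map_star (ampLeft r) K).symm
  change (K * (Matrix.of fun a b => X (p.1, a) (q.1, b)) * Kᴴ - (1 / 2 : ℂ) •
      (Kᴴ * K * (Matrix.of fun a b => X (p.1, a) (q.1, b)) +
        (Matrix.of fun a b => X (p.1, a) (q.1, b)) * (Kᴴ * K))) p.2 q.2 =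
    (ampLeft r K * X * (ampLeft r K)ᴴ - (1 / 2 : ℂ) •
      ((ampLeft r K)ᴴ * ampLeft r K * X + X * ((ampLeft r K)ᴴ * ampLeft r K))) p q
  rw [hs, ← map_mul, ← hl K, ← hl (Kᴴ * K), ← hr, ← hr]
  rfl

theorem trace_mul_idTensor_semigroup (K : Matrix n n ℂ) (t : ℝ) (X Y : Matrix (r × n) (r × n) ℂ) :
    (Y * idTensor r (semigroup (lindbladian K) t) X).trace =
      (NormedSpace.exp ((t : ℂ) • adjointLindbladian (ampLeft r K)) Y * X).trace := by
  rw [idTensor_semigroup, idTensor_lindbladian]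
  exact trace_mul_semigroup (fun X Y => trace_mul_lindbladian _ X Y) t X Y

end Duality

/-! ### Simulation with an ancilla -/

section Ancilla

variable {n m r : Type*} [Fintype n] [DecidableEq n] [Fintype m] [DecidableEq m]
  [Fintype r] [DecidableEq r]

/-- The operator `I ⊗ |ψ⟩`, which appends the vector `ψ` as an ancilla. -/
def appendVec (r n : Type*) [DecidableEq r] [DecidableEq n] (ψ : m → ℂ) :
    Matrix (r × (n × m)) (r × n) ℂ :=
  Matrix.of fun p q => if p.1 = q.1 ∧ p.2.1 = q.2 then ψ p.2.2 else 0

omit [DecidableEq m] in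
theorem conjTranspose_appendVec_mul_self {ψ : m → ℂ} (hψ : ∑ k, ψ k * star (ψ k) = 1) :
    (appendVec r n ψ)ᴴ * appendVec r n ψ = 1 := by
  ext ⟨i, a⟩ ⟨j, b⟩
  have h : ∑ k, star (ψ k) * ψ k = 1 := by simpa only [mul_comm] using hψ
  by_cases hi : i = j
  · by_cases ha : a = b
    · subst hi ha
      rw [Matrix.one_apply_eq, ← h]
      simp [Matrix.mul_apply, Fintype.sum_prod_type, appendVec, ite_and, Finset.sum_ite_irrel,
        apply_ite (starRingEnd ℂ)]
    · rw [Matrix.one_apply_ne (by simp [ha])]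
      refine Finset.sum_eq_zero fun p _ => ?_
      simp only [appendVec, Matrix.conjTranspose_apply, Matrix.of_apply]
      grind [star_zero]
  · rw [Matrix.one_apply_ne (by simp [hi])]
    refine Finset.sum_eq_zero fun p _ => ?_
    simp only [appendVec, Matrix.conjTranspose_apply, Matrix.of_apply]
    grind [star_zero]

theorem ampRight_mul_appendVec (ψ : m → ℂ) (Y : Matrix (r × n) (r × n) ℂ) :
    ampRight m Y * appendVec r n ψ = appendVec r n ψ * Y := by
  ext ⟨i, a, k⟩ ⟨j, b⟩
  simp [Matrix.mul_apply, Fintype.sum_prod_type, appendVec, ampRight_apply, ite_and, mul_comm]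

theorem trace_mul_partialTrace (Y : Matrix (r × n) (r × n) ℂ)
    (Z : Matrix (r × (n × m)) (r × (n × m)) ℂ) :
    (Y * Matrix.of fun p q : r × n => ∑ k, Z (p.1, p.2, k) (q.1, q.2, k)).trace =
      (ampRight m Y * Z).trace := by
  simp only [Matrix.trace, Matrix.diag_apply, Matrix.mul_apply, Fintype.sum_prod_type,
    ampRight_apply, Matrix.of_apply, ite_mul, zero_mul, Finset.sum_ite_eq, Finset.mem_univ,
    if_true, Finset.mul_sum]
  refine Finset.sum_congr rfl fun i _ => Finset.sum_congr rfl fun a _ => ?_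
  rw [Finset.sum_comm (s := (Finset.univ : Finset m))]
  refine Finset.sum_congr rfl fun j _ => ?_
  rw [Finset.sum_comm (s := (Finset.univ : Finset m))]

/-- The map `Y ↦ (I ⊗ ⟨ψ|) F(Y ⊗ I) (I ⊗ |ψ⟩)`, dual to tensoring with `|ψ⟩⟨ψ|`, applying the
map dual to `F` and tracing out the ancilla. -/
noncomputable def ancillaDual (ψ : m → ℂ)
    (F : Matrix (r × (n × m)) (r × (n × m)) ℂ →L[ℂ] Matrix (r × (n × m)) (r × (n × m)) ℂ) :
    Matrix (r × n) (r × n) ℂ →L[ℂ] Matrix (r × n) (r × n) ℂ :=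
  LinearMap.toContinuousLinearMap
    { toFun := fun Y => (appendVec r n ψ)ᴴ * F (ampRight m Y) * appendVec r n ψ
      map_add' := fun X Y => by simp only [map_add, Matrix.mul_add, Matrix.add_mul]
      map_smul' := fun c X => by
        simp only [map_smul, Matrix.mul_smul, Matrix.smul_mul, RingHom.id_apply] }

variable {ψ : m → ℂ}

theorem ancillaDual_apply
    (F : Matrix (r × (n × m)) (r × (n × m)) ℂ →L[ℂ] Matrix (r × (n × m)) (r × (n × m)) ℂ)
    (Y : Matrix (r × n) (r × n) ℂ) :
    ancillaDual ψ F Y = (appendVec r n ψ)ᴴ * F (ampRight m Y) * appendVec r n ψ := rfl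

theorem ancillaDual_sub
    (F G : Matrix (r × (n × m)) (r × (n × m)) ℂ →L[ℂ] Matrix (r × (n × m)) (r × (n × m)) ℂ) :
    ancillaDual ψ (F - G) = ancillaDual ψ F - ancillaDual ψ G := by
  refine ContinuousLinearMap.ext fun Y => ?_
  simp only [ancillaDual_apply, _root_.sub_apply, Matrix.mul_sub, Matrix.sub_mul]

theorem ancillaDual_smul (c : ℂ)
    (F : Matrix (r × (n × m)) (r × (n × m)) ℂ →L[ℂ] Matrix (r × (n × m)) (r × (n × m)) ℂ) :
    ancillaDual ψ (c • F) = c • ancillaDual ψ F := by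
  refine ContinuousLinearMap.ext fun Y => ?_
  simp only [ancillaDual_apply, _root_.smul_apply, Matrix.mul_smul, Matrix.smul_mul]

theorem norm_ancillaDual_le (hψ : ∑ k, ψ k * star (ψ k) = 1)
    (F : Matrix (r × (n × m)) (r × (n × m)) ℂ →L[ℂ] Matrix (r × (n × m)) (r × (n × m)) ℂ) :
    ‖ancillaDual ψ F‖ ≤ ‖F‖ := by
  refine ContinuousLinearMap.opNorm_le_bound _ (norm_nonneg _) fun Y => ?_
  have hV := norm_le_one_of_isometry (conjTranspose_appendVec_mul_self (r := r) (n := n) hψ)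
  rw [ancillaDual_apply]
  refine (norm_conj_mul_conj_le _).trans ?_
  refine (mul_le_of_le_one_left (norm_nonneg _) (pow_le_one₀ (norm_nonneg _) hV)).trans ?_
  exact (F.le_opNorm _).trans
    (mul_le_mul_of_nonneg_left (norm_ampRight_le Y) (norm_nonneg _))

theorem conj_appendVec_ampRight (hψ : ∑ k, ψ k * star (ψ k) = 1) (Y : Matrix (r × n) (r × n) ℂ) :
    (appendVec r n ψ)ᴴ * ampRight m Y * appendVec r n ψ = Y := by
  rw [Matrix.mul_assoc, ampRight_mul_appendVec, ← Matrix.mul_assoc,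
    conjTranspose_appendVec_mul_self hψ, Matrix.one_mul]

theorem ancillaDual_one (hψ : ∑ k, ψ k * star (ψ k) = 1) :
    ancillaDual (r := r) (n := n) ψ 1 = 1 :=
  ContinuousLinearMap.ext fun Y => conj_appendVec_ampRight hψ Y

/-- An operator `K` with `K (I ⊗ |ψ⟩) = L ⊗ |χ⟩` simulates the Lindblad operator `L` to first
order. -/
theorem ancillaDual_adjointLindbladian {χ : m → ℂ} (hχ : ∑ k, χ k * star (χ k) = 1)
    {K : Matrix (r × (n × m)) (r × (n × m)) ℂ} {L : Matrix (r × n) (r × n) ℂ}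
    (h : K * appendVec r n ψ = appendVec r n χ * L) :
    ancillaDual ψ (adjointLindbladian K) = adjointLindbladian L := by
  refine ContinuousLinearMap.ext fun Y => ?_
  rw [ancillaDual_apply, adjointLindbladian_apply, adjointLindbladian_apply]
  set V := appendVec r n ψ
  set W := appendVec r n χ
  have h' : Vᴴ * Kᴴ = Lᴴ * Wᴴ := by
    rw [← Matrix.conjTranspose_mul, h, Matrix.conjTranspose_mul]
  have hWW : Wᴴ * W = 1 := conjTranspose_appendVec_mul_self hχ
  have hYV : ampRight m Y * V = V * Y := ampRight_mul_appendVec ψ Y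
  have hVY : Vᴴ * ampRight m Y = Y * Vᴴ := by
    have := congrArg Matrix.conjTranspose (ampRight_mul_appendVec (r := r) (n := n) ψ Yᴴ)
    rw [Matrix.conjTranspose_mul, Matrix.conjTranspose_mul, Matrix.conjTranspose_conjTranspose,
      show (ampRight m Yᴴ)ᴴ = ampRight m Y from by
        rw [← Matrix.star_eq_conjTranspose, ← map_star, Matrix.star_eq_conjTranspose,
          Matrix.conjTranspose_conjTranspose]] at this
    exact this
  -- In all three terms `K` meets `V`, directly or after commuting `Y ⊗ I` past `V`. Replacing `KV`
  -- by `WL` and using `W†(Y ⊗ I)W = Y` removes the ancilla; of `χ` only its unit norm matters.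
  have hLL : Vᴴ * (Kᴴ * K) * V = Lᴴ * L := by
    calc Vᴴ * (Kᴴ * K) * V = (Vᴴ * Kᴴ) * (K * V) := by simp only [Matrix.mul_assoc]
      _ = Lᴴ * (Wᴴ * W) * L := by rw [h, h']; simp only [Matrix.mul_assoc]
      _ = Lᴴ * L := by rw [hWW, Matrix.mul_one]
  have e1 : Vᴴ * (Kᴴ * ampRight m Y * K) * V = Lᴴ * Y * L := by
    calc _ = (Vᴴ * Kᴴ) * ampRight m Y * (K * V) := by simp only [Matrix.mul_assoc]
      _ = Lᴴ * (Wᴴ * ampRight m Y * W) * L := by rw [h, h']; simp only [Matrix.mul_assoc]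
      _ = Lᴴ * Y * L := by rw [conj_appendVec_ampRight hχ]
  have e2 : Vᴴ * (Kᴴ * K * ampRight m Y) * V = Lᴴ * L * Y := by
    rw [← hLL]
    calc _ = Vᴴ * (Kᴴ * K) * (ampRight m Y * V) := by simp only [Matrix.mul_assoc]
      _ = _ := by rw [hYV]; simp only [Matrix.mul_assoc]
  have e3 : Vᴴ * (ampRight m Y * (Kᴴ * K)) * V = Y * (Lᴴ * L) := by
    rw [← hLL]
    calc _ = Vᴴ * ampRight m Y * (Kᴴ * K) * V := by simp only [Matrix.mul_assoc]
      _ = _ := by rw [hVY]; simp only [Matrix.mul_assoc]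
  simp only [Matrix.mul_sub, Matrix.sub_mul, Matrix.mul_smul, Matrix.smul_mul, Matrix.mul_add,
    Matrix.add_mul, e1, e2, e3]

/-- The error of one step of a simulation which is exact to first order. -/
theorem norm_exp_sub_ancillaDual_exp_le (hψ : ∑ k, ψ k * star (ψ k) = 1) {χ : m → ℂ}
    (hχ : ∑ k, χ k * star (χ k) = 1)
    {K : Matrix (r × (n × m)) (r × (n × m)) ℂ} {L : Matrix (r × n) (r × n) ℂ}
    (h : K * appendVec r n ψ = appendVec r n χ * L) {c t : ℝ} (hK : ‖K‖ ^ 2 ≤ c) (ht : 0 ≤ t)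
    (hct : 2 * c * t ≤ 1) :
    ‖NormedSpace.exp ((t : ℂ) • adjointLindbladian L) -
      ancillaDual ψ (NormedSpace.exp ((t : ℂ) • adjointLindbladian K))‖ ≤
        2 * (13 / 18 * (2 * c * t) ^ 2) := by
  -- As `L = W†KV` with `V` and `W` isometries, `‖L‖ ≤ ‖K‖`, so the same `c` serves both generators.
  have hL : ‖L‖ ^ 2 ≤ c := by
    refine le_trans (pow_le_pow_left₀ (norm_nonneg _) ?_ 2) hK
    have e : L = (appendVec r n χ)ᴴ * (K * appendVec r n ψ) := by
      rw [h, ← Matrix.mul_assoc, conjTranspose_appendVec_mul_self hχ, Matrix.one_mul]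
    have hV := norm_le_one_of_isometry (conjTranspose_appendVec_mul_self (r := r) (n := n) hψ)
    have hW := norm_le_one_of_isometry (conjTranspose_appendVec_mul_self (r := r) (n := n) hχ)
    rw [← Matrix.l2_opNorm_conjTranspose] at hW
    rw [e]
    calc _ ≤ ‖(appendVec r n χ)ᴴ‖ * (‖K‖ * ‖appendVec r n ψ‖) :=
          (Matrix.l2_opNorm_mul _ _).trans
            (mul_le_mul_of_nonneg_left (Matrix.l2_opNorm_mul _ _) (norm_nonneg _))
      _ ≤ 1 * (‖K‖ * 1) := by gcongr
      _ = ‖K‖ := by ring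
  have e1 := norm_exp_adjointLindbladian_sub_le L ht hL hct
  have e2 := (norm_ancillaDual_le hψ _).trans (norm_exp_adjointLindbladian_sub_le K ht hK hct)
  -- Compression preserves the terms of order zero and one of `exp(t𝓛†)`, so only the two
  -- second-order remainders survive in the difference.
  rw [ancillaDual_sub, ancillaDual_sub, ancillaDual_smul, ancillaDual_one hψ,
    ancillaDual_adjointLindbladian hχ h] at e2
  have e3 := norm_sub_le_of_le e1 e2
  rw [sub_sub_sub_cancel_right, sub_sub_sub_cancel_right] at e3
  linarith

end Ancilla

/-! ### The wave matrix operator and program state -/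

section WaveMatrix

variable {d : ℕ} {r : Type*} [Fintype r] [DecidableEq r]

theorem mulVec_gammaVec (L : Matrix (Fin d) (Fin d) ℂ) :
    (L ⊗ₖ (1 : Matrix (Fin d) (Fin d) ℂ)) *ᵥ gammaVec d = fun p => L p.1 p.2 := by
  ext ⟨a, b⟩
  simp [Matrix.mulVec, dotProduct, Fintype.sum_prod_type, gammaVec, Matrix.one_apply]

theorem wmlOp_apply (p q : Fin d × (Fin d × Fin d)) :
    wmlOp d p q = ((1 / √d : ℝ) : ℂ) *
      (if p.2.1 = p.2.2 ∧ p.1 = q.2.1 ∧ q.1 = q.2.2 then 1 else 0) := by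
  obtain ⟨a, b, c⟩ := p
  obtain ⟨a', b', c'⟩ := q
  rw [wmlOp, Matrix.smul_apply, smul_eq_mul]
  congr 1
  simp [Matrix.mul_apply, Fintype.sum_prod_type, gammaVec, Matrix.vecMulVec_apply, swapOp,
    Matrix.one_apply, Matrix.sum_apply, Matrix.single_apply, ite_and]
  grind

/-- The normalized maximally entangled vector. -/
noncomputable def maxEntVec (d : ℕ) : Fin d × Fin d → ℂ := fun p => ((1 / √d : ℝ) : ℂ) * gammaVec d p

theorem sum_maxEntVec (hd : d ≠ 0) : ∑ k, maxEntVec d k * star (maxEntVec d k) = 1 := by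
  have h : ((√d : ℝ) : ℂ) * ((√d : ℝ) : ℂ) = d := by
    rw [← Complex.ofReal_mul, Real.mul_self_sqrt (Nat.cast_nonneg d), Complex.ofReal_natCast]
  have hd' : (d : ℂ) ≠ 0 := by exact_mod_cast hd
  simp [maxEntVec, gammaVec, Fintype.sum_prod_type, ← mul_inv, h, hd']

/-- The operator `I_R ⊗ (I₂ ⊗ ⟨Γ|₁₃)` from `R ⊗ 1 ⊗ 2 ⊗ 3` to `R ⊗ 1`. -/
def wmlBra (r : Type*) [DecidableEq r] (d : ℕ) :
    Matrix (r × Fin d) (r × (Fin d × (Fin d × Fin d))) ℂ :=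
  Matrix.of fun p q => if p.1 = q.1 ∧ p.2 = q.2.2.1 ∧ q.2.1 = q.2.2.2 then 1 else 0

/-- The swap moves system 1 into the pair contracted by `⟨Γ|` and leaves system 2 as output, while
`d^{-1/2}|Γ⟩` is the unit vector prepared on the ancilla. This factorization yields both the
intertwining relation and the bound `‖M‖² ≤ d`. -/
theorem ampLeft_wmlOp :
    ampLeft r (wmlOp d) = appendVec r (Fin d) (maxEntVec d) * wmlBra r d := by
  ext ⟨i, a, b, c⟩ ⟨j, a', b', c'⟩
  rw [ampLeft_apply, Matrix.kroneckerMap_apply, wmlOp_apply]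
  simp [Matrix.mul_apply, Fintype.sum_prod_type, appendVec, wmlBra, maxEntVec, gammaVec,
    Matrix.one_apply, ite_and]
  grind

theorem wmlBra_mul_appendVec (L : Matrix (Fin d) (Fin d) ℂ) :
    wmlBra r d * appendVec r (Fin d) (fun p : Fin d × Fin d => L p.1 p.2) = ampLeft r L := by
  ext ⟨i, a⟩ ⟨j, b⟩
  rw [ampLeft_apply, Matrix.kroneckerMap_apply]
  simp [Matrix.mul_apply, Fintype.sum_prod_type, appendVec, wmlBra, Matrix.one_apply, ite_and]

theorem ampLeft_wmlOp_mul_appendVec (L : Matrix (Fin d) (Fin d) ℂ) :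
    ampLeft r (wmlOp d) * appendVec r (Fin d) (fun p : Fin d × Fin d => L p.1 p.2) =
      appendVec r (Fin d) (maxEntVec d) * ampLeft r L := by
  rw [ampLeft_wmlOp, Matrix.mul_assoc, wmlBra_mul_appendVec]

theorem wmlBra_mul_conjTranspose :
    wmlBra r d * (wmlBra r d)ᴴ = ((d : ℝ) : ℂ) • (1 : Matrix (r × Fin d) (r × Fin d) ℂ) := by
  ext ⟨i, a⟩ ⟨j, b⟩
  simp [Matrix.mul_apply, Fintype.sum_prod_type, wmlBra, Matrix.one_apply, ite_and,
    apply_ite (starRingEnd ℂ)]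

theorem norm_ampLeft_wmlOp_sq_le (hd : d ≠ 0) : ‖ampLeft r (wmlOp d)‖ ^ 2 ≤ d := by
  have hU : ‖wmlBra r d‖ ≤ √d := by
    rw [← Matrix.l2_opNorm_conjTranspose]
    refine norm_le_sqrt_of_conjTranspose_mul_self (Nat.cast_nonneg d) ?_
    rw [Matrix.conjTranspose_conjTranspose, wmlBra_mul_conjTranspose]
  have hW := norm_le_one_of_isometry
    (conjTranspose_appendVec_mul_self (r := r) (n := Fin d) (sum_maxEntVec hd))
  rw [← Real.sq_sqrt (Nat.cast_nonneg d), ampLeft_wmlOp]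
  refine pow_le_pow_left₀ (norm_nonneg _) ?_ 2
  calc _ ≤ ‖appendVec r (Fin d) (maxEntVec d)‖ * ‖wmlBra r d‖ := Matrix.l2_opNorm_mul _ _
    _ ≤ 1 * √d := by gcongr
    _ = √d := one_mul _

theorem trace_mul_idTensor_wmlStep (L : Matrix (Fin d) (Fin d) ℂ) (t : ℝ)
    (X Y : Matrix (r × Fin d) (r × Fin d) ℂ) :
    (Y * idTensor r (wmlStep L t) X).trace =
      (ancillaDual (fun p : Fin d × Fin d => L p.1 p.2)
        (NormedSpace.exp ((t : ℂ) • adjointLindbladian (ampLeft r (wmlOp d)))) Y * X).trace := by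
  set V := appendVec r (Fin d) (fun p : Fin d × Fin d => L p.1 p.2) with hV
  have h : idTensor r (wmlStep L t) X = Matrix.of fun p q : r × Fin d => ∑ k,
      idTensor r (semigroup (lindbladian (wmlOp d)) t) (V * X * Vᴴ) (p.1, p.2, k) (q.1, q.2, k) := by
    ext ⟨i, a⟩ ⟨j, b⟩
    -- The program state is pure, so tensoring with it is the conjugation `X ↦ VXV†`, blockwise in
    -- the reference system.
    have hb : (Matrix.of fun a b => X (i, a) (j, b)) ⊗ₖ programState L =
        Matrix.of fun p q => (V * X * Vᴴ) (i, p) (j, q) := by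
      ext ⟨a, k⟩ ⟨b, l⟩
      rw [programState, mulVec_gammaVec]
      simp [Matrix.mul_apply, Fintype.sum_prod_type, hV, appendVec, Matrix.vecMulVec_apply, ite_and,
        apply_ite (starRingEnd ℂ)]
      ring
    change ∑ k, semigroup (lindbladian (wmlOp d)) t
      ((Matrix.of fun a b => X (i, a) (j, b)) ⊗ₖ programState L) (a, k) (b, k) = _
    rw [hb]
    rfl
  rw [h, trace_mul_partialTrace, trace_mul_idTensor_semigroup, ancillaDual_apply, ← hV,
    ← Matrix.mul_assoc, Matrix.trace_mul_comm]
  simp only [Matrix.mul_assoc]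

end WaveMatrix

/-! ### From operator-norm duality to the diamond distance -/

/-- The factor `2` cancels the `½` of the normalized distance. Nonemptiness comes for free, since an
empty system carries no matrix of trace 1; it gives the operator algebra an identity of norm 1. -/
theorem diamondDist_le {n : Type*} [Fintype n] [DecidableEq n] {N M : Module.End ℂ (Matrix n n ℂ)}
    {c : ℝ} (hc : 0 ≤ c)
    (h : ∀ (r : ℕ) (_ : Nonempty (Fin r × n)) (X Y : Matrix (Fin r × n) (Fin r × n) ℂ),
      IsDensity X → ‖(Y * (idTensor (Fin r) N X - idTensor (Fin r) M X)).trace‖ ≤ 2 * c * ‖Y‖) :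
    diamondDist N M ≤ ENNReal.ofReal c := by
  have key : ∀ (r : ℕ) (ρ : Matrix (Fin r × n) (Fin r × n) ℂ) (_ : IsDensity ρ),
      ENNReal.ofReal (schattenNorm 1 (idTensor (Fin r) N ρ - idTensor (Fin r) M ρ)) ≤
        ENNReal.ofReal (2 * c) := by
    intro r ρ hρ
    refine ENNReal.ofReal_le_ofReal (schattenNorm_one_le (by positivity) fun Y => h r ?_ ρ Y hρ)
    by_contra hn
    rw [not_nonempty_iff] at hn
    have := hρ.2
    simp [Matrix.trace] at this
  rw [diamondDist]
  calc _ ≤ 1 / 2 * ENNReal.ofReal (2 * c) := by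
        gcongr
        exact iSup_le fun r => iSup_le fun ρ => iSup_le fun hρ => key r ρ hρ
    _ = ENNReal.ofReal c := by
        rw [ENNReal.ofReal_mul zero_le_two, ENNReal.ofReal_ofNat, ← mul_assoc, one_div,
          ENNReal.inv_mul_cancel two_ne_zero ENNReal.ofNat_ne_top, one_mul]

end WML

theorem theorem3 (d : ℕ) (hd : 2 ≤ d) (L : Matrix (Fin d) (Fin d) ℂ)
    (hL : WML.schattenNorm 2 L = 1) (t : ℝ) (ht : 0 ≤ t) (n : ℕ) (hn : 2 * (d : ℝ) * t < n) :
    WML.diamondDist (WML.semigroup (WML.lindbladian L) t) ((WML.wmlStep L (t / n)) ^ n) ≤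
      ENNReal.ofReal (3 * t ^ 2 * (d : ℝ) ^ 2 / n) := by
  have hn0 : (0 : ℝ) < n := lt_of_le_of_lt (by positivity) hn
  have hd0 : d ≠ 0 := by omega
  refine WML.diamondDist_le (by positivity) fun r _ ρ Y hρ => ?_
  set ψ : Fin d × Fin d → ℂ := fun p => L p.1 p.2
  have hψ : ∑ k, ψ k * star (ψ k) = 1 := by
    rw [Fintype.sum_prod_type]
    exact WML.sum_normSq_of_schattenNorm_two hL
  have hs : 0 ≤ t / n := by positivity
  set E := NormedSpace.exp
    (((t / n : ℝ) : ℂ) • WML.adjointLindbladian (WML.ampLeft (Fin r) L)) with hE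
  set T := WML.ancillaDual (r := Fin r) (n := Fin d) ψ (NormedSpace.exp
    (((t / n : ℝ) : ℂ) • WML.adjointLindbladian (WML.ampLeft (Fin r) (WML.wmlOp d)))) with hT
  have : Nonempty (Fin r × (Fin d × Fin d × Fin d)) := by
    obtain ⟨i, a⟩ := ‹Nonempty (Fin r × Fin d)›
    exact ⟨i, a, a, a⟩
  have hE1 : ‖E‖ ≤ 1 := WML.norm_exp_adjointLindbladian_le_one _ hs
  have hT1 : ‖T‖ ≤ 1 := (WML.norm_ancillaDual_le hψ _).trans
    (WML.norm_exp_adjointLindbladian_le_one _ hs)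
  have hET : ‖E - T‖ ≤ 2 * (13 / 18 * (2 * d * (t / n)) ^ 2) := by
    refine WML.norm_exp_sub_ancillaDual_exp_le hψ (WML.sum_maxEntVec hd0)
      (WML.ampLeft_wmlOp_mul_appendVec L)
      (WML.norm_ampLeft_wmlOp_sq_le hd0) hs ?_
    rw [← mul_div_assoc, div_le_one hn0]
    exact hn.le
  have hpow : ‖E ^ n - T ^ n‖ ≤ 2 * (3 * t ^ 2 * (d : ℝ) ^ 2 / n) := by
    refine (WML.norm_pow_sub_pow_le (R := Matrix (Fin r × Fin d) (Fin r × Fin d) ℂ →L[ℂ]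
      Matrix (Fin r × Fin d) (Fin r × Fin d) ℂ) hE1 hT1 n).trans
      ((mul_le_mul_of_nonneg_left hET hn0.le).trans ?_)
    -- The constant `2 · (13/18) · 4 = 52/9` lies below the allowed `6`.
    have e : (n : ℝ) * (2 * (13 / 18 * (2 * d * (t / n)) ^ 2)) =
        2 * (13 / 18 * 4) * (t ^ 2 * (d : ℝ) ^ 2 / n) := by
      field_simp
      ring
    have : 0 ≤ t ^ 2 * (d : ℝ) ^ 2 / n := by positivity
    rw [e, show 2 * (3 * t ^ 2 * (d : ℝ) ^ 2 / n) = 2 * 3 * (t ^ 2 * (d : ℝ) ^ 2 / n) by ring]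
    nlinarith
  have hEn : NormedSpace.exp ((t : ℂ) • WML.adjointLindbladian (WML.ampLeft (Fin r) L)) = E ^ n :=
    WML.exp_smul_eq_pow (A := Matrix (Fin r × Fin d) (Fin r × Fin d) ℂ →L[ℂ]
      Matrix (Fin r × Fin d) (Fin r × Fin d) ℂ) _ t (by exact_mod_cast hn0.ne')
  rw [Matrix.mul_sub, Matrix.trace_sub, WML.trace_mul_idTensor_semigroup, hEn, WML.idTensor_pow,
    WML.trace_mul_pow (fun X Y => WML.trace_mul_idTensor_wmlStep L (t / n) X Y), ← hT,
    ← Matrix.trace_sub, ← Matrix.sub_mul, ← _root_.sub_apply]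
  exact (hρ.norm_trace_mul_le _).trans ((E ^ n - T ^ n).le_of_opNorm_le hpow Y)
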